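/- For $t\in(0,\sqrt2\,]$ put $\Delta_t=\frac{2-t^2}{2}$, $\mu_t=\arccos(-\Delta_t)$ and $I_t=(-(\pi-\mu_t),\,\pi-\mu_t)$. Let $(t,x,y)\mapsto\Theta_t(x,y)$ be the unique real analytic function on $\{(t,x,y): 0<t\le\sqrt2,\ x,y\in I_t\}$ with $\Theta_{\sqrt2}(0,0)=0$ and $$e^{-i\Theta_t(x,y)}=e^{i(x-y)}\,\frac{e^{-ix}+e^{iy}-2\Delta_t}{e^{-iy}+e^{ix}-2\Delta_t}$$ (explicitly, $\Theta_t(x,y)=2\arctan\frac{\sin x-\sin y}{\cos x+\cos y-2\Delta_t}-(x-y)$). Theorem. Let $n,N$ be non-negative integers with $2n\le N+1$, that is, $n<\frac N2+1$. There exists a unique sequence of real analytic functions $p_1,\dots,p_n$ on $(0,\sqrt2)$ such that for all $t\in(0,\sqrt2)$ and all $1\le j\le n$ one has $p_j(t)\in I_t\subset(-\pi,\pi)$ and $$N p_j(t)=2\pi j-(n+1)\pi-\sum_{k=1}^n\Theta_t\big(p_j(t),p_k(t)\big).$$ Moreover $p_{n-j+1}(t)=-p_j(t)$ for all $t\in(0,\sqrt2)$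 and all $1\le j\le n$, and for every $t\in(0,\sqrt2)$ the numbers $p_1(t),\dots,p_n(t)$ are pairwise distinct. -/

import Mathlib

open Real Set

noncomputable section

/-- `Δ_t = (2 - t²) / 2`. -/
def betheDelta (t : ℝ) : ℝ := (2 - t ^ 2) / 2

/-- `μ_t = μ(-Δ_t)`, where `μ : (-1,1) → (0,π)` is the inverse of `cos : (0,π) → (-1,1)`. -/
def betheMu (t : ℝ) : ℝ := Real.arccos (-betheDelta t)

/-- The open interval `I_t = (-(π - μ_t), π - μ_t)`. -/
def betheInterval (t : ℝ) : Set ℝ := Ioo (-(π - betheMu t)) (π - betheMu t)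

/-- The set of all `(t, x, y)` with `0 < t ≤ √2` and `x, y ∈ I_t`. The endpoint `t = √2` is included
because `Θ` is normalised there. -/
def betheDomain : Set (ℝ × ℝ × ℝ) :=
  {q | q.1 ∈ Ioc 0 (√2) ∧ q.2.1 ∈ betheInterval q.1 ∧ q.2.2 ∈ betheInterval q.1}

/-- The properties that characterise the function `(t, x, y) ↦ Θ_t(x, y)`: it is real analytic, it
vanishes at `(√2, 0, 0)`, and
`exp(-iΘ_t(x,y)) = exp(i(x-y)) (e^{-ix} + e^{iy} - 2Δ_t) / (e^{-iy} + e^{ix} - 2Δ_t)`. -/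
structure IsBetheTheta (Θ : ℝ → ℝ → ℝ → ℝ) : Prop where
  analytic : AnalyticOnNhd ℝ (fun q : ℝ × ℝ × ℝ => Θ q.1 q.2.1 q.2.2) betheDomain
  base : Θ (√2) 0 0 = 0
  exp_eq : ∀ t x y : ℝ, (t, x, y) ∈ betheDomain →
    Complex.exp (-Complex.I * (Θ t x y : ℂ)) =
      Complex.exp (Complex.I * ((x : ℂ) - (y : ℂ))) *
        ((Complex.exp (-Complex.I * (x : ℂ)) + Complex.exp (Complex.I * (y : ℂ))
            - 2 * (betheDelta t : ℂ)) /
          (Complex.exp (-Complex.I * (y : ℂ)) + Complex.exp (Complex.I * (x : ℂ))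
            - 2 * (betheDelta t : ℂ)))

/-- The function `Θ_t(x, y)`, in closed form. By `isBetheTheta_betheTheta` and
`IsBetheTheta.eq_betheTheta` below it is the unique function with the properties in
`IsBetheTheta`. -/
def betheTheta (t x y : ℝ) : ℝ :=
  2 * Real.arctan ((sin x - sin y) / (cos x + cos y - 2 * betheDelta t)) - (x - y)

/-- A family `p_1, …, p_n` of functions of `t` (here indexed by `Fin n`, so that `p_j` is
`p ⟨j - 1, _⟩`) is an analytic solution of the Bethe equations: every `p_j` is real analytic on
`(0, √2)`, takes its values in `I_t`, and for all `t ∈ (0, √2)` and all `j`,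
`N p_j(t) = 2πj - (n+1)π - ∑_k Θ_t(p_j(t), p_k(t))`. -/
structure IsAnalyticBetheSolution (n N : ℕ) (p : Fin n → ℝ → ℝ) : Prop where
  analytic : ∀ j, AnalyticOnNhd ℝ (p j) (Ioo 0 (√2))
  mem : ∀ t ∈ Ioo (0 : ℝ) (√2), ∀ j, p j t ∈ betheInterval t
  bethe : ∀ t ∈ Ioo (0 : ℝ) (√2), ∀ j : Fin n,
    (N : ℝ) * p j t = 2 * π * ((j : ℕ) + 1 : ℝ) - ((n : ℝ) + 1) * π
      - ∑ k : Fin n, betheTheta t (p j t) (p k t)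

/-! ### `betheTheta` is the function characterised by `IsBetheTheta` -/

theorem betheInterval_eq (t : ℝ) :
    betheInterval t = Ioo (-Real.arccos (betheDelta t)) (Real.arccos (betheDelta t)) := by
  simp [betheInterval, betheMu, Real.arccos_neg]

theorem betheDelta_lt_cos {t x : ℝ} (hx : x ∈ betheInterval t) : betheDelta t < cos x := by
  rw [betheInterval_eq] at hx
  have h : |x| < Real.arccos (betheDelta t) := abs_lt.2 hx
  rw [← Real.cos_abs x]
  by_contra! hc
  have h2 := Real.arccos_le_arccos hc
  rw [Real.arccos_cos (abs_nonneg x) (h.le.trans (Real.arccos_le_pi _))] at h2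
  linarith

theorem betheDen_pos {t x y : ℝ} (hx : x ∈ betheInterval t) (hy : y ∈ betheInterval t) :
    0 < cos x + cos y - 2 * betheDelta t := by
  linarith [betheDelta_lt_cos hx, betheDelta_lt_cos hy]

theorem zero_mem_betheInterval {t : ℝ} (ht : t ∈ Ioc 0 (√2)) : (0 : ℝ) ∈ betheInterval t := by
  have h : betheDelta t < 1 := by
    have := pow_pos ht.1 2
    unfold betheDelta; linarith
  rw [betheInterval_eq]
  have := Real.arccos_pos.2 h
  exact ⟨by linarith, this⟩

theorem isBetheTheta_betheTheta : IsBetheTheta betheTheta where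
  analytic := by
    rintro ⟨t, x, y⟩ ⟨-, hx, hy⟩
    have hd := (betheDen_pos hx hy).ne'
    apply ContDiffAt.analyticAt
    unfold betheTheta betheDelta
    unfold betheDelta at hd
    refine ContDiffAt.sub (contDiffAt_const.mul
      (Real.contDiff_arctan.contDiffAt.comp _ (ContDiffAt.div ?_ ?_ hd))) ?_ <;> fun_prop
  base := by simp [betheTheta]
  exp_eq := by
    rintro t x y ⟨-, hx, hy⟩
    have hd := betheDen_pos hx hy
    set c := cos x + cos y - 2 * betheDelta t with hc
    set s := sin x - sin y with hs
    have e1 : Complex.exp (-Complex.I * (x : ℂ)) + Complex.exp (Complex.I * (y : ℂ))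
            - 2 * (betheDelta t : ℂ) = (c : ℂ) - (s : ℂ) * Complex.I := by
      rw [show -Complex.I * (x : ℂ) = (-x : ℂ) * Complex.I by ring, mul_comm Complex.I,
        Complex.exp_mul_I, Complex.exp_mul_I, hc, hs]
      push_cast [Complex.cos_neg, Complex.sin_neg]
      ring
    have e2 : Complex.exp (-Complex.I * (y : ℂ)) + Complex.exp (Complex.I * (x : ℂ))
            - 2 * (betheDelta t : ℂ) = (c : ℂ) + (s : ℂ) * Complex.I := by
      rw [show -Complex.I * (y : ℂ) = (-y : ℂ) * Complex.I by ring, mul_comm Complex.I,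
        Complex.exp_mul_I, Complex.exp_mul_I, hc, hs]
      push_cast [Complex.cos_neg, Complex.sin_neg]
      ring
    set a := Real.arctan (s / c) with ha
    have hca : cos a ≠ 0 := (Real.cos_arctan_pos _).ne'
    have hsa : sin a * c = s * cos a := by
      have h := Real.tan_arctan (s / c)
      rw [← ha, Real.tan_eq_sin_div_cos, div_eq_div_iff hca hd.ne'] at h
      exact h
    have hsaC : Complex.sin a * c = s * Complex.cos a := by exact_mod_cast hsa
    have hcaC : Complex.cos (a : ℂ) ≠ 0 := by exact_mod_cast hca
    have hcC : (c : ℂ) ≠ 0 := by exact_mod_cast hd.ne'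
    have hden : (c : ℂ) + (s : ℂ) * Complex.I ≠ 0 := by
      intro h
      have := congrArg Complex.re h
      simp at this
      exact hd.ne' this
    have key : Complex.exp (-(a : ℂ) * Complex.I) * ((c : ℂ) + s * Complex.I)
        = Complex.exp ((a : ℂ) * Complex.I) * ((c : ℂ) - s * Complex.I) := by
      rw [Complex.exp_mul_I, Complex.exp_mul_I, Complex.cos_neg, Complex.sin_neg]
      linear_combination (-2 * Complex.I) * hsaC
    rw [e1, e2]
    have e3 : -Complex.I * ((betheTheta t x y : ℝ) : ℂ)
        = Complex.I * ((x : ℂ) - y) + (-(a : ℂ) * Complex.I + -(a : ℂ) * Complex.I) := by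
      simp only [betheTheta, ← hc, ← hs, ← ha]
      push_cast
      ring
    rw [e3, Complex.exp_add, Complex.exp_add]
    congr 1
    rw [eq_div_iff hden, mul_assoc, key, ← mul_assoc, ← Complex.exp_add]
    simp

theorem isPreconnected_betheDomain : IsPreconnected betheDomain := by
  have h2 : (√2 : ℝ) ∈ Ioc 0 (√2) := ⟨by positivity, le_rfl⟩
  refine isPreconnected_of_forall (√2, 0, 0) ?_
  rintro ⟨t, x, y⟩ ⟨ht, hx, hy⟩
  simp only at ht hx hy
  refine ⟨(fun r : ℝ => ((r, 0, 0) : ℝ × ℝ × ℝ)) '' Icc t (√2) ∪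
    (fun r : ℝ => ((t, r * x, r * y) : ℝ × ℝ × ℝ)) '' Icc 0 1, ?_, ?_, ?_, ?_⟩
  · rintro _ (⟨r, hr, rfl⟩ | ⟨r, hr, rfl⟩)
    · have hr' : r ∈ Ioc 0 (√2) := ⟨ht.1.trans_le hr.1, hr.2⟩
      exact ⟨hr', zero_mem_betheInterval hr', zero_mem_betheInterval hr'⟩
    · have key : ∀ z ∈ betheInterval t, r * z ∈ betheInterval t := by
        intro z hz
        have h0 := zero_mem_betheInterval ht
        have := (convex_Ioo (-(π - betheMu t)) (π - betheMu t)) h0 hz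
          (sub_nonneg.2 hr.2) hr.1 (by ring)
        simpa [betheInterval] using this
      exact ⟨ht, key x hx, key y hy⟩
  · exact Or.inl ⟨√2, ⟨ht.2, le_rfl⟩, rfl⟩
  · exact Or.inr ⟨1, by simp, by simp⟩
  · refine IsPreconnected.union (t, 0, 0) ⟨t, ⟨le_rfl, ht.2⟩, rfl⟩ ⟨0, by simp, by simp⟩ ?_ ?_
    · exact isPreconnected_Icc.image _ (by fun_prop)
    · exact isPreconnected_Icc.image _ (by fun_prop)

theorem IsBetheTheta.eq_betheTheta {Θ : ℝ → ℝ → ℝ → ℝ} (h : IsBetheTheta Θ) {t x y : ℝ}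
    (hq : (t, x, y) ∈ betheDomain) : Θ t x y = betheTheta t x y := by
  have h' := isBetheTheta_betheTheta
  set f : ℝ × ℝ × ℝ → ℝ := fun q =>
    (Θ q.1 q.2.1 q.2.2 - betheTheta q.1 q.2.1 q.2.2) / (2 * π) with hf
  have hcont : ContinuousOn f betheDomain :=
    (h.analytic.continuousOn.sub h'.analytic.continuousOn).div_const _
  have hmaps : MapsTo f betheDomain (Set.range ((↑) : ℤ → ℝ)) := by
    rintro ⟨t, x, y⟩ hq
    have he := (h.exp_eq t x y hq).trans (h'.exp_eq t x y hq).symm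
    obtain ⟨k, hk⟩ := Complex.exp_eq_exp_iff_exists_int.1 he
    refine ⟨-k, ?_⟩
    have hk2 : (Θ t x y : ℂ) - betheTheta t x y = (-k : ℂ) * (2 * π) := by
      have hI := Complex.I_mul_I
      linear_combination Complex.I * hk + (Θ t x y - betheTheta t x y + k * (2 * π)) * hI
    have hk3 : Θ t x y - betheTheta t x y = (-k : ℝ) * (2 * π) := by exact_mod_cast hk2
    simp only [hf]
    rw [hk3]
    push_cast
    field_simp
  have : DiscreteTopology (Set.range ((↑) : ℤ → ℝ)) :=
    (Int.isClosedEmbedding_coe_real.isEmbedding.toHomeomorph).symm.isEmbedding.discreteTopology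
  have h2 : (√2 : ℝ) ∈ Ioc 0 (√2) := ⟨by positivity, le_rfl⟩
  have hb : ((√2, 0, 0) : ℝ × ℝ × ℝ) ∈ betheDomain :=
    ⟨h2, zero_mem_betheInterval h2, zero_mem_betheInterval h2⟩
  have he := isPreconnected_betheDomain.constant_of_mapsTo (isDiscrete_iff_discreteTopology.2 this) hcont hmaps hq hb
  simp only [hf, h.base, h'.base, sub_self, zero_div] at he
  rcases div_eq_zero_iff.1 he with h0 | h0
  · linarith
  · exact absurd h0 (by positivity)

end

/-! In rapidities the Bethe equations become the critical point equations of a convex function. Put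
`T = betheTan t`, which lies in (0, 1) for t in (0, √2). The substitution x = 2 arctan(T tanh a)
maps ℝ onto I_t and turns Θ_t(x, y) into an odd increasing function of a - b
(`betheTheta_rapidityPhase`). The equations then say that the gradient of `yangYang` vanishes.

Uniqueness is strict monotonicity of that gradient (`betheMap_injective`). Existence is coercivity
(`exists_betheMap_eq`): as rapidities grow, the momentum term gains at rate N · 2 arctan T while the
quantum numbers cost at most (n - 1) · 4 arctan T, so 2n < N + 2 is exactly what the estimate needs.

The linearized equations have trivial kernel, so the implicit function theorem gives analyticity
(`contDiffAt_of_betheRapidityMap_eq`). Antisymmetry follows from uniqueness, and distinctness from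
that of the quantum numbers. -/

noncomputable section

/-! ### Convexity and coercivity of the Yang–Yang action -/

section Variational

open Filter

variable {n : ℕ}

/-- The left-hand side of the Bethe equations in rapidity variables, with one-particle
momentum `f` and two-particle phase `g`. -/
def betheMap (N : ℕ) (f g : ℝ → ℝ) (a : Fin n → ℝ) (j : Fin n) : ℝ :=
  N * f (a j) + ∑ l, g (a j - a l)

/-- Exchange j and l and average. Pair interactions then appear only through differences, where
monotonicity fixes their sign. -/
theorem sum_mul_sum_of_antisymm (v : Fin n → ℝ) (h : Fin n → Fin n → ℝ)
    (hh : ∀ j l, h l j = -h j l) :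
    ∑ j, v j * ∑ l, h j l = 1 / 2 * ∑ j, ∑ l, h j l * (v j - v l) := by
  have h1 : ∑ j, ∑ l, h j l * v l = -∑ j, v j * ∑ l, h j l := by
    rw [Finset.sum_comm, ← Finset.sum_neg_distrib]
    refine Finset.sum_congr rfl fun j _ => ?_
    rw [Finset.mul_sum, ← Finset.sum_neg_distrib]
    refine Finset.sum_congr rfl fun l _ => ?_
    rw [hh j l]; ring
  have h2 : ∑ j, ∑ l, h j l * v j = ∑ j, v j * ∑ l, h j l := by
    refine Finset.sum_congr rfl fun j _ => ?_
    rw [Finset.mul_sum]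
    exact Finset.sum_congr rfl fun l _ => mul_comm _ _
  simp only [mul_sub, Finset.sum_sub_distrib, h1, h2]
  ring

/-- Pair the difference of the two values with a - b: the one-particle and two-particle sums are
both nonnegative, so both vanish, and strictness of f forces a = b. -/
theorem betheMap_injective {N : ℕ} (hN : 0 < N) {f g : ℝ → ℝ} (hf : StrictMono f)
    (hg : Monotone g) (hodd : ∀ x, g (-x) = -g x) :
    Function.Injective (betheMap (n := n) N f g) := by
  intro a b hab
  have key : ∑ j, (a j - b j) * (N * (f (a j) - f (b j)))
      + ∑ j, (a j - b j) * ∑ l, (g (a j - a l) - g (b j - b l)) = 0 := by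
    rw [← Finset.sum_add_distrib]
    refine Finset.sum_eq_zero fun j _ => ?_
    have := congrFun hab j
    simp only [betheMap] at this
    rw [Finset.sum_sub_distrib]
    linear_combination (a j - b j) * this
  rw [sum_mul_sum_of_antisymm] at key
  · have mono_mul : ∀ {u : ℝ → ℝ}, Monotone u → ∀ x y, 0 ≤ (x - y) * (u x - u y) := by
      intro u hu x y
      rcases le_total x y with h | h
      · exact mul_nonneg_of_nonpos_of_nonpos (by linarith) (by linarith [hu h])
      · exact mul_nonneg (by linarith) (by linarith [hu h])
    have h2 : 0 ≤ ∑ j, ∑ l, (g (a j - a l) - g (b j - b l)) * ((a j - b j) - (a l - b l)) := by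
      refine Finset.sum_nonneg fun j _ => Finset.sum_nonneg fun l _ => ?_
      have := mono_mul hg (a j - a l) (b j - b l)
      nlinarith
    have h3 : ∀ j ∈ Finset.univ, 0 ≤ (a j - b j) * (N * (f (a j) - f (b j))) := by
      intro j _
      have := mul_nonneg (Nat.cast_nonneg (α := ℝ) N) (mono_mul hf.monotone (a j) (b j))
      nlinarith
    have h4 : ∑ j, (a j - b j) * (N * (f (a j) - f (b j))) = 0 :=
      le_antisymm (by linarith) (Finset.sum_nonneg h3)
    funext j
    have h5 := (Finset.sum_eq_zero_iff_of_nonneg h3).1 h4 j (Finset.mem_univ j)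
    have hN' : (N : ℝ) ≠ 0 := by exact_mod_cast hN.ne'
    rcases mul_eq_zero.1 h5 with h | h
    · linarith
    · rcases mul_eq_zero.1 h with h | h
      · exact absurd h hN'
      · exact hf.injective (by linarith)
  · intro j l
    rw [← neg_sub (a j), ← neg_sub (b j), hodd, hodd]
    ring

theorem hasDerivAt_primitive {f : ℝ → ℝ} (hf : Continuous f) (x : ℝ) :
    HasDerivAt (fun a => ∫ s in (0 : ℝ)..a, f s) (f x) x :=
  (hf.integral_hasStrictDerivAt 0 x).hasDerivAt

theorem tangent_le_primitive {f : ℝ → ℝ} (hf : Continuous f) (hm : Monotone f) (x r : ℝ) :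
    (∫ s in (0 : ℝ)..r, f s) + f r * (x - r) ≤ ∫ s in (0 : ℝ)..x, f s := by
  have h : ∀ a b, IntervalIntegrable f MeasureTheory.volume a b := fun a b =>
    hf.intervalIntegrable a b
  rw [← intervalIntegral.integral_add_adjacent_intervals (h 0 r) (h r x)]
  refine add_le_add le_rfl ?_
  rcases le_total r x with hx | hx
  · have := intervalIntegral.integral_mono_on hx
      (intervalIntegrable_const (c := f r)) (h r x) (fun s hs => hm hs.1)
    simp only [intervalIntegral.integral_const, smul_eq_mul] at this
    linarith
  · have := intervalIntegral.integral_mono_on hx (h x r)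
      (intervalIntegrable_const (c := f r)) (fun s hs => hm hs.2)
    simp only [intervalIntegral.integral_const, smul_eq_mul] at this
    rw [intervalIntegral.integral_symm]
    linarith

/-- The primitive is convex and nonnegative; its tangents at r and -r bound it below on the two
half-lines. -/
theorem mul_abs_sub_le_primitive {f : ℝ → ℝ} (hf : Continuous f) (hm : Monotone f)
    (hodd : ∀ x, f (-x) = -f x) (x r : ℝ) :
    f r * |x| - f r * r ≤ ∫ s in (0 : ℝ)..x, f s := by
  have h0 : f 0 = 0 := by have := hodd 0; rw [neg_zero] at this; linarith
  have hpos : ∀ y, 0 ≤ ∫ s in (0 : ℝ)..y, f s := fun y => by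
    have := tangent_le_primitive hf hm y 0
    simpa [h0] using this
  have h1 := tangent_le_primitive hf hm x r
  have h2 := tangent_le_primitive hf hm x (-r)
  rw [hodd] at h2
  rcases abs_cases x with ⟨h, -⟩ | ⟨h, -⟩ <;> rw [h] <;> linarith [hpos r, hpos (-r)]

/-- The factor is n - 1 rather than n because the diagonal vanishes; the sharp condition on n and N
depends on this. -/
theorem sum_sum_abs_sub_le (a : Fin n → ℝ) :
    ∑ j, ∑ l, |a j - a l| ≤ 2 * ((n : ℝ) - 1) * ∑ j, |a j| := by
  have h : ∀ j l, |a j - a l| ≤ |a j| + |a l| - if j = l then 2 * |a j| else 0 := by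
    intro j l
    split_ifs with h
    · subst h; simp; linarith
    · simpa using abs_sub (a j) (a l)
  refine (Finset.sum_le_sum fun j _ => Finset.sum_le_sum fun l _ => h j l).trans (le_of_eq ?_)
  simp [Finset.sum_add_distrib, Finset.sum_sub_distrib, ← Finset.mul_sum]
  ring

/-- The Yang–Yang action, whose critical points are the solutions of the Bethe equations. -/
def yangYang (N : ℕ) (f g : ℝ → ℝ) (σ : Fin n → Fin n → ℝ) (a : Fin n → ℝ) : ℝ :=
  N * ∑ j, (∫ s in (0 : ℝ)..a j, f s)
    + 1 / 2 * ∑ j, ∑ l, ((∫ s in (0 : ℝ)..(a j - a l), g s) - σ j l * (a j - a l))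

theorem hasDerivAt_yangYang {N : ℕ} {f g : ℝ → ℝ} {σ : Fin n → Fin n → ℝ} (hf : Continuous f)
    (hg : Continuous g) (hgo : ∀ x, g (-x) = -g x) (hσ : ∀ j l, σ l j = -σ j l)
    (a v : Fin n → ℝ) :
    HasDerivAt (fun s : ℝ => yangYang N f g σ (fun j => a j + s * v j))
      (∑ j, v j * (betheMap N f g a j - ∑ l, σ j l)) 0 := by
  have hline : ∀ x w : ℝ, HasDerivAt (fun s : ℝ => x + s * w) w 0 := fun x w => by
    simpa using ((hasDerivAt_id (0 : ℝ)).mul_const w).const_add x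
  have hF : ∀ {u : ℝ → ℝ}, Continuous u → ∀ x w : ℝ,
      HasDerivAt (fun s : ℝ => ∫ r in (0 : ℝ)..(x + s * w), u r) (u x * w) 0 := fun hu x w => by
    have h := hasDerivAt_primitive hu (x + 0 * w)
    have := h.comp (0 : ℝ) (hline x w)
    simpa [Function.comp_def] using this
  have h1 : HasDerivAt (fun s : ℝ => (N : ℝ) * ∑ j, ∫ r in (0 : ℝ)..(a j + s * v j), f r)
      (N * ∑ j, f (a j) * v j) 0 :=
    (HasDerivAt.fun_sum fun j _ => hF hf (a j) (v j)).const_mul _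
  have h2 : HasDerivAt (fun s : ℝ => (1 / 2 : ℝ) * ∑ j, ∑ l,
      ((∫ r in (0 : ℝ)..((a j + s * v j) - (a l + s * v l)), g r)
        - σ j l * ((a j + s * v j) - (a l + s * v l))))
      (1 / 2 * ∑ j, ∑ l, (g (a j - a l) - σ j l) * (v j - v l)) 0 := by
    refine (HasDerivAt.fun_sum fun j _ => HasDerivAt.fun_sum fun l _ => ?_).const_mul _
    have e : ∀ s : ℝ, (a j + s * v j) - (a l + s * v l) = (a j - a l) + s * (v j - v l) :=
      fun s => by ring
    simp only [e, sub_mul]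
    exact (hF hg _ _).sub ((hline _ _).const_mul _)
  refine (h1.add h2).congr_deriv ?_
  rw [← sum_mul_sum_of_antisymm, Finset.mul_sum, ← Finset.sum_add_distrib]
  · refine Finset.sum_congr rfl fun j _ => ?_
    rw [betheMap, Finset.sum_sub_distrib]
    ring
  · intro j l
    rw [← neg_sub (a j), hgo, hσ]
    ring

theorem yangYang_ge {N : ℕ} {f g : ℝ → ℝ} {σ : Fin n → Fin n → ℝ} {κ r : ℝ}
    (hf : Continuous f) (hg : Continuous g) (hfm : Monotone f) (hgm : Monotone g)
    (hfo : ∀ x, f (-x) = -f x) (hgo : ∀ x, g (-x) = -g x)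
    (hκ : ∀ j l, |σ j l| ≤ κ) (hgr : g r ≤ κ) (a : Fin n → ℝ) :
    (N * f r - ((n : ℝ) - 1) * (κ - g r)) * ∑ j, |a j|
      - (N * (n * (f r * r)) + 1 / 2 * (n * (n * (g r * r)))) ≤ yangYang N f g σ a := by
  have h1 : (N : ℝ) * ∑ j, (f r * |a j| - f r * r) ≤ N * ∑ j, ∫ s in (0 : ℝ)..a j, f s :=
    mul_le_mul_of_nonneg_left
      (Finset.sum_le_sum fun j _ => mul_abs_sub_le_primitive hf hfm hfo _ _) (Nat.cast_nonneg N)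
  have h2 : ∑ j, ∑ l, ((g r - κ) * |a j - a l| - g r * r) ≤
      ∑ j, ∑ l, ((∫ s in (0 : ℝ)..(a j - a l), g s) - σ j l * (a j - a l)) := by
    refine Finset.sum_le_sum fun j _ => Finset.sum_le_sum fun l _ => ?_
    have e1 := mul_abs_sub_le_primitive hg hgm hgo (a j - a l) r
    have e2 : σ j l * (a j - a l) ≤ κ * |a j - a l| :=
      (le_abs_self _).trans (by rw [abs_mul]; gcongr; exact hκ j l)
    linarith
  have h3 := mul_le_mul_of_nonneg_left (sum_sum_abs_sub_le a) (sub_nonneg.2 hgr)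
  have e1 : ∑ j, (f r * |a j| - f r * r) = f r * ∑ j, |a j| - n * (f r * r) := by
    simp [Finset.sum_sub_distrib, Finset.mul_sum]
  have e2 : ∑ j, ∑ l, ((g r - κ) * |a j - a l| - g r * r)
      = (g r - κ) * ∑ j, ∑ l, |a j - a l| - n * (n * (g r * r)) := by
    simp [Finset.sum_sub_distrib, Finset.mul_sum]
  rw [e1] at h1
  rw [e2] at h2
  unfold yangYang
  linarith

theorem continuous_yangYang {N : ℕ} {f g : ℝ → ℝ} {σ : Fin n → Fin n → ℝ}
    (hf : Continuous f) (hg : Continuous g) : Continuous (yangYang N f g σ) := by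
  have hF : Continuous fun a : ℝ => ∫ s in (0 : ℝ)..a, f s :=
    continuous_iff_continuousAt.2 fun x => (hasDerivAt_primitive hf x).continuousAt
  have hG : Continuous fun a : ℝ => ∫ s in (0 : ℝ)..a, g s :=
    continuous_iff_continuousAt.2 fun x => (hasDerivAt_primitive hg x).continuousAt
  unfold yangYang
  refine Continuous.add (continuous_const.mul (continuous_finsetSum _ fun j _ => ?_))
    (continuous_const.mul (continuous_finsetSum _ fun j _ => continuous_finsetSum _ fun l _ => ?_))
  · exact hF.comp (continuous_apply j)
  · exact (hG.comp ((continuous_apply j).sub (continuous_apply l))).sub (by fun_prop)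

theorem exists_betheMap_eq {N : ℕ} {f g : ℝ → ℝ} {σ : Fin n → Fin n → ℝ} {κ r : ℝ}
    (hf : Continuous f) (hg : Continuous g) (hfm : Monotone f) (hgm : Monotone g)
    (hfo : ∀ x, f (-x) = -f x) (hgo : ∀ x, g (-x) = -g x) (hσ : ∀ j l, σ l j = -σ j l)
    (hκ : ∀ j l, |σ j l| ≤ κ) (hgr : g r ≤ κ)
    (hr : ((n : ℝ) - 1) * (κ - g r) < N * f r) :
    ∃ a : Fin n → ℝ, ∀ j, betheMap N f g a j = ∑ l, σ j l := by
  have htends : Tendsto (yangYang N f g σ) (cocompact _) atTop := by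
    refine tendsto_atTop_mono (f := fun a : Fin n → ℝ =>
      (N * f r - ((n : ℝ) - 1) * (κ - g r)) * ‖a‖
      - (N * (n * (f r * r)) + 1 / 2 * (n * (n * (g r * r))))) (fun a => ?_) ?_
    · refine le_trans ?_ (yangYang_ge hf hg hfm hgm hfo hgo hκ hgr a)
      have : ‖a‖ ≤ ∑ j, |a j| := by
        refine (pi_norm_le_iff_of_nonneg (Finset.sum_nonneg fun j _ => abs_nonneg _)).2 fun j => ?_
        exact Finset.single_le_sum (f := fun j => |a j|) (fun _ _ => abs_nonneg _)
          (Finset.mem_univ j)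
      have := mul_le_mul_of_nonneg_left this (sub_pos.2 hr).le
      linarith
    · exact tendsto_atTop_add_const_right _ _
        ((tendsto_norm_cocompact_atTop).const_mul_atTop (sub_pos.2 hr))
  obtain ⟨a, ha⟩ := (continuous_yangYang hf hg).exists_forall_le htends
  refine ⟨a, ?_⟩
  -- Differentiating at the minimum along the gradient itself gives a vanishing sum of squares.
  set v : Fin n → ℝ := fun j => betheMap N f g a j - ∑ l, σ j l with hv
  have hd := hasDerivAt_yangYang (N := N) hf hg hgo hσ a v
  have hmin : IsLocalMin (fun s : ℝ => yangYang N f g σ (fun j => a j + s * v j)) 0 :=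
    Eventually.of_forall fun s => by simpa using ha _
  have h0 := hmin.hasDerivAt_eq_zero hd
  intro j
  have := (Finset.sum_eq_zero_iff_of_nonneg fun j _ => mul_self_nonneg (v j)).1 h0 j
    (Finset.mem_univ j)
  have := mul_self_eq_zero.1 this
  simp only [hv] at this
  linarith

end Variational


/-! ### Rapidity coordinates -/

section Rapidity

/-- The function `a ↦ 2 arctan (c tanh a)`, which gives both the momentum and the two-particle
phase in terms of rapidities. -/
def rapidityPhase (c a : ℝ) : ℝ := 2 * Real.arctan (c * tanh a)

/-- The derivative of `rapidityPhase c`. -/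
def rapiditySlope (c a : ℝ) : ℝ :=
  2 * (c * ((1 - tanh a ^ 2) / (1 + (c * tanh a) ^ 2)))

theorem hasDerivAt_tanh (a : ℝ) : HasDerivAt tanh (1 - tanh a ^ 2) a := by
  have h := (Real.hasDerivAt_sinh a).div (Real.hasDerivAt_cosh a) (Real.cosh_pos a).ne'
  have e : (fun x => sinh x / cosh x) = tanh := by
    funext x; rw [Real.tanh_eq_sinh_div_cosh]
  have h' : HasDerivAt tanh ((cosh a * cosh a - sinh a * sinh a) / cosh a ^ 2) a := by
    rw [← e]; exact h
  refine h'.congr_deriv ?_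
  have := (Real.cosh_pos a).ne'
  rw [Real.tanh_eq_sinh_div_cosh]
  field_simp

theorem contDiff_tanh {m : WithTop ℕ∞} : ContDiff ℝ m tanh := by
  have e : (fun x => sinh x / cosh x) = tanh := by
    funext x; rw [Real.tanh_eq_sinh_div_cosh]
  rw [← e]
  exact Real.contDiff_sinh.div Real.contDiff_cosh fun x => (Real.cosh_pos x).ne'

theorem hasDerivAt_rapidityPhase (c a : ℝ) :
    HasDerivAt (rapidityPhase c) (rapiditySlope c a) a := by
  refine ((((hasDerivAt_tanh a).const_mul c).arctan).const_mul 2).congr_deriv ?_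
  rw [rapiditySlope]
  ring

theorem rapiditySlope_pos {c : ℝ} (hc : 0 < c) (a : ℝ) : 0 < rapiditySlope c a := by
  have := sub_pos.2 (tanh_sq_lt_one a)
  unfold rapiditySlope
  positivity

theorem rapidityPhase_strictMono {c : ℝ} (hc : 0 < c) : StrictMono (rapidityPhase c) :=
  strictMono_of_hasDerivAt_pos (fun a => hasDerivAt_rapidityPhase c a) (rapiditySlope_pos hc)

theorem continuous_rapidityPhase (c : ℝ) : Continuous (rapidityPhase c) :=
  continuous_iff_continuousAt.2 fun a => (hasDerivAt_rapidityPhase c a).continuousAt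

theorem rapidityPhase_neg (c a : ℝ) : rapidityPhase c (-a) = -rapidityPhase c a := by
  simp [rapidityPhase]

theorem rapiditySlope_neg (c a : ℝ) : rapiditySlope c (-a) = rapiditySlope c a := by
  simp [rapiditySlope]

/-- The coefficient of the two-particle phase, when that of the momentum is `c`. -/
def phaseCoeff (c : ℝ) : ℝ := (1 - c ^ 2) / (2 * c)

theorem phaseCoeff_pos {c : ℝ} (hc : c ∈ Ioo (0 : ℝ) 1) : 0 < phaseCoeff c := by
  have h0 := hc.1
  have : 0 < 1 - c ^ 2 := by nlinarith [hc.2]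
  unfold phaseCoeff
  positivity

/-- `phaseCoeff c` is the cotangent of 2 arctan c. Hence the limiting phase falls short of π by
exactly twice the limiting momentum 2 arctan c. -/
theorem arctan_phaseCoeff {c : ℝ} (hc : c ∈ Ioo (0 : ℝ) 1) :
    2 * Real.arctan (phaseCoeff c) = π - 4 * Real.arctan c := by
  have h1 := Real.two_mul_arctan (x := c) (by linarith [hc.1]) hc.2
  have h2 := Real.arctan_inv_of_pos (phaseCoeff_pos hc)
  have e : (phaseCoeff c)⁻¹ = 2 * c / (1 - c ^ 2) := by rw [phaseCoeff, inv_div]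
  rw [e, ← h1] at h2
  linarith

/-- `tan (η / 2)`, where `cos η = Δ_t`. -/
def betheTan (t : ℝ) : ℝ := t / √(4 - t ^ 2)

theorem four_sub_sq_pos {t : ℝ} (ht : t ∈ Ioo 0 (√2)) : 2 < 4 - t ^ 2 := by
  have := (Real.lt_sqrt ht.1.le).1 ht.2
  linarith

theorem betheTan_sq {t : ℝ} (ht : t ∈ Ioo 0 (√2)) : betheTan t ^ 2 = t ^ 2 / (4 - t ^ 2) := by
  have := four_sub_sq_pos ht
  rw [betheTan, div_pow, Real.sq_sqrt (by linarith)]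

theorem betheTan_mem {t : ℝ} (ht : t ∈ Ioo 0 (√2)) : betheTan t ∈ Ioo (0 : ℝ) 1 := by
  have h := four_sub_sq_pos ht
  have h0 : 0 < betheTan t := div_pos ht.1 (Real.sqrt_pos.2 (by linarith))
  refine ⟨h0, ?_⟩
  have h2 : betheTan t ^ 2 < 1 := by
    rw [betheTan_sq ht, div_lt_one (by linarith)]; linarith
  nlinarith

theorem betheDelta_eq {t : ℝ} (ht : t ∈ Ioo 0 (√2)) :
    betheDelta t = (1 - betheTan t ^ 2) / (1 + betheTan t ^ 2) := by
  have h := four_sub_sq_pos ht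
  have h' : (4 - t ^ 2) ≠ 0 := by linarith
  rw [betheTan_sq ht, betheDelta]
  field_simp
  ring

theorem contDiffAt_betheTan {t : ℝ} (ht : t ∈ Ioo 0 (√2)) {m : WithTop ℕ∞} :
    ContDiffAt ℝ m betheTan t := by
  have h := four_sub_sq_pos ht
  unfold betheTan
  refine contDiffAt_id.div (ContDiffAt.sqrt (by fun_prop) (by linarith)) ?_
  exact (Real.sqrt_pos.2 (by linarith)).ne'

theorem cos_two_mul_arctan (u : ℝ) : cos (2 * Real.arctan u) = (1 - u ^ 2) / (1 + u ^ 2) := by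
  have : 1 + u ^ 2 ≠ 0 := by positivity
  rw [Real.cos_two_mul, Real.cos_sq_arctan]
  field_simp
  ring

theorem sin_two_mul_arctan (u : ℝ) : sin (2 * Real.arctan u) = 2 * u / (1 + u ^ 2) := by
  have h : 1 + u ^ 2 ≠ 0 := by positivity
  have h2 : sin (Real.arctan u) = u * cos (Real.arctan u) := by
    have := Real.tan_mul_cos (Real.cos_arctan_pos u).ne'
    rw [Real.tan_arctan] at this
    exact this.symm
  rw [Real.sin_two_mul, h2]
  have := Real.cos_sq_arctan u
  linear_combination 2 * u * this

theorem betheInterval_eq_arctan {t : ℝ} (ht : t ∈ Ioo 0 (√2)) :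
    betheInterval t = Ioo (-(2 * Real.arctan (betheTan t))) (2 * Real.arctan (betheTan t)) := by
  have h := Real.arctan_pos.2 (betheTan_mem ht).1
  rw [betheInterval_eq, betheDelta_eq ht, ← cos_two_mul_arctan, Real.arccos_cos (by linarith)]
  linarith [Real.arctan_lt_pi_div_two (betheTan t)]

theorem rapidityPhase_mem_betheInterval {t : ℝ} (ht : t ∈ Ioo 0 (√2)) (a : ℝ) :
    rapidityPhase (betheTan t) a ∈ betheInterval t := by
  have h0 := (betheTan_mem ht).1
  rw [betheInterval_eq_arctan ht, rapidityPhase]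
  have h1 := Real.arctan_strictMono (mul_lt_mul_of_pos_left (tanh_lt_one a) h0)
  have h2 := Real.arctan_strictMono (mul_lt_mul_of_pos_left (neg_one_lt_tanh a) h0)
  rw [mul_one] at h1
  rw [mul_neg_one, Real.arctan_neg] at h2
  constructor <;> linarith

theorem exists_rapidityPhase_eq {t : ℝ} (ht : t ∈ Ioo 0 (√2)) {x : ℝ}
    (hx : x ∈ betheInterval t) : ∃ a, rapidityPhase (betheTan t) a = x := by
  have h0 := (betheTan_mem ht).1
  rw [betheInterval_eq_arctan ht] at hx
  have hT := Real.arctan_lt_pi_div_two (betheTan t)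
  have hmem : x / 2 ∈ Ioo (-(π / 2)) (π / 2) := ⟨by linarith [hx.1], by linarith [hx.2]⟩
  have hat := Real.arctan_tan hmem.1 hmem.2
  have h1 : tan (x / 2) < betheTan t := by
    rw [← Real.arctan_lt_arctan_iff, hat]; linarith [hx.2]
  have h2 : -betheTan t < tan (x / 2) := by
    rw [← Real.arctan_lt_arctan_iff, hat, Real.arctan_neg]; linarith [hx.1]
  refine ⟨artanh (tan (x / 2) / betheTan t), ?_⟩
  rw [rapidityPhase, Real.tanh_artanh, mul_div_cancel₀ _ h0.ne', hat]
  · ring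
  · exact ⟨by rw [lt_div_iff₀ h0]; linarith, by rw [div_lt_one h0]; exact h1⟩

theorem tanh_sub (a b : ℝ) : tanh (a - b) = (tanh a - tanh b) / (1 - tanh a * tanh b) := by
  have ha := (Real.cosh_pos a).ne'
  have hb := (Real.cosh_pos b).ne'
  have h := (Real.cosh_pos (a - b)).ne'
  rw [Real.cosh_sub] at h
  simp only [Real.tanh_eq_sinh_div_cosh, Real.sinh_sub, Real.cosh_sub]
  have h' : 1 - sinh a / cosh a * (sinh b / cosh b) ≠ 0 := by
    rw [show 1 - sinh a / cosh a * (sinh b / cosh b)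
      = (cosh a * cosh b - sinh a * sinh b) / (cosh a * cosh b) by field_simp]
    exact div_ne_zero h (mul_ne_zero ha hb)
  rw [div_eq_div_iff h h']
  field_simp

/-- With u = tanh a and v = tanh b everything is rational inside arctangents, and the claim reduces
to two uses of the arctangent addition formula. -/
theorem betheTheta_rapidityPhase {t : ℝ} (ht : t ∈ Ioo 0 (√2)) (a b : ℝ) :
    betheTheta t (rapidityPhase (betheTan t) a) (rapidityPhase (betheTan t) b)
      = rapidityPhase (phaseCoeff (betheTan t)) (a - b) := by
  have hden := (betheDen_pos (rapidityPhase_mem_betheInterval ht a)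
    (rapidityPhase_mem_betheInterval ht b)).ne'
  obtain ⟨hT0, hT1⟩ := betheTan_mem ht
  unfold betheTheta
  rw [betheDelta_eq ht] at hden ⊢
  simp only [rapidityPhase, cos_two_mul_arctan, sin_two_mul_arctan, tanh_sub, phaseCoeff] at hden ⊢
  set T := betheTan t
  have hu := tanh_sq_lt_one a
  have hv := tanh_sq_lt_one b
  generalize tanh a = u at *
  generalize tanh b = v at *
  have huv : 0 < 1 - u * v := by nlinarith [sq_nonneg (u - v)]
  have hTuv : 0 < 1 + T * u * (T * v) := by
    have h1 : T ^ 2 < 1 := by nlinarith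
    have h2 : -1 < u * v := by nlinarith [sq_nonneg (u + v)]
    nlinarith [sq_nonneg T]
  -- This says that the product of the two arguments in `hadd` is below 1, so the addition formula
  -- needs no multiple of π.
  have hD : 0 < 2 * (1 - u * v) * (1 + T * u * (T * v)) - (1 - T ^ 2) * (u - v) ^ 2 := by
    have : 2 * (1 - u * v) * (1 + T * u * (T * v)) - (1 - T ^ 2) * (u - v) ^ 2
      = (1 - u ^ 2) + (1 - v ^ 2) + T ^ 2 * (u ^ 2 * (1 - v ^ 2) + v ^ 2 * (1 - u ^ 2)) := by ring
    rw [this]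
    have h1 := sub_pos.2 hu
    have h2 := sub_pos.2 hv
    positivity
  have hsub : Real.arctan (T * u) - Real.arctan (T * v)
      = Real.arctan ((T * u - T * v) / (1 + T * u * (T * v))) := by
    rw [sub_eq_add_neg, ← Real.arctan_neg, Real.arctan_add (by linarith)]
    congr 1; ring
  have hadd : Real.arctan ((1 - T ^ 2) / (2 * T) * ((u - v) / (1 - u * v)))
      + Real.arctan ((T * u - T * v) / (1 + T * u * (T * v)))
      = Real.arctan ((2 * (T * u) / (1 + (T * u) ^ 2) - 2 * (T * v) / (1 + (T * v) ^ 2)) /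
        ((1 - (T * u) ^ 2) / (1 + (T * u) ^ 2) + (1 - (T * v) ^ 2) / (1 + (T * v) ^ 2)
          - 2 * ((1 - T ^ 2) / (1 + T ^ 2)))) := by
    have e1 : (1 - T ^ 2) / (2 * T) * ((u - v) / (1 - u * v)) *
        ((T * u - T * v) / (1 + T * u * (T * v)))
        = (1 - T ^ 2) * (u - v) ^ 2 / (2 * (1 - u * v) * (1 + T * u * (T * v))) := by
      field_simp
    have hlt : (1 - T ^ 2) / (2 * T) * ((u - v) / (1 - u * v)) *
        ((T * u - T * v) / (1 + T * u * (T * v))) < 1 := by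
      rw [e1, div_lt_one (by positivity)]
      linarith
    rw [Real.arctan_add hlt]
    congr 1
    rw [div_eq_div_iff (sub_pos.2 hlt).ne' hden]
    have hA : 1 + (T * u) ^ 2 ≠ 0 := by positivity
    have hB : 1 + (T * v) ^ 2 ≠ 0 := by positivity
    have hC : 1 + T ^ 2 ≠ 0 := by positivity
    obtain ⟨W, hW⟩ : ∃ W, W = 1 + T * u * (T * v) := ⟨_, rfl⟩
    rw [← hW] at hTuv ⊢
    field_simp
    rw [hW]
    ring
  linarith

end Rapidity


/-! ### Existence, analyticity and symmetry of the Bethe roots -/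

section Bethe

open Filter
open scoped Topology ContDiff

variable {n N : ℕ}

/-- The Bethe equations in rapidity variables, with momentum coefficient `c`. -/
def betheRapidityMap (N : ℕ) (c : ℝ) (a : Fin n → ℝ) : Fin n → ℝ :=
  betheMap N (rapidityPhase c) (rapidityPhase (phaseCoeff c)) a

theorem betheRapidityMap_injective (hN : 0 < N) {c : ℝ} (hc : c ∈ Ioo (0 : ℝ) 1) :
    Function.Injective (betheRapidityMap (n := n) N c) :=
  betheMap_injective hN (rapidityPhase_strictMono hc.1)
    (rapidityPhase_strictMono (phaseCoeff_pos hc)).monotone (rapidityPhase_neg _)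

/-- The quantum number of the `j`-th Bethe root. -/
def betheNumber (j : Fin n) : ℝ := 2 * π * ((j : ℕ) + 1 : ℝ) - ((n : ℝ) + 1) * π

/-- Splits the quantum number into antisymmetric pair terms of size at most π, which the pair phases
can nearly balance. -/
theorem betheNumber_eq_sum (j : Fin n) :
    betheNumber j = ∑ l : Fin n, ((if l < j then π else 0) - if j < l then π else 0) := by
  have h1 : (Finset.univ.filter fun l => l < j).card = (j : ℕ) := by
    rw [← Fin.card_Iio]; congr 1; ext; simp
  have h2 : (Finset.univ.filter fun l => j < l).card = n - 1 - (j : ℕ) := by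
    rw [← Fin.card_Ioi]; congr 1; ext; simp
  have h3 : ((n - 1 - (j : ℕ) : ℕ) : ℝ) = n - 1 - j := by
    have := j.2
    rw [Nat.cast_sub (by omega), Nat.cast_sub (by omega)]; simp
  rw [Finset.sum_sub_distrib, ← Finset.sum_filter, ← Finset.sum_filter, Finset.sum_const,
    Finset.sum_const, h1, h2, nsmul_eq_mul, nsmul_eq_mul, h3, betheNumber]
  ring

theorem exists_betheRapidityMap_eq (hnN : 2 * n ≤ N + 1) {c : ℝ} (hc : c ∈ Ioo (0 : ℝ) 1) :
    ∃ a : Fin n → ℝ, betheRapidityMap N c a = betheNumber := by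
  obtain ⟨r, hr⟩ : ∃ r, ((n : ℝ) - 1) * (π - rapidityPhase (phaseCoeff c) r)
      < N * rapidityPhase c r := by
    -- Here s stands for tanh r. At the limit s = 1 the value is (N - 2n + 2) · 2 arctan c > 0, and
    -- continuity yields an admissible s < 1.
    set h : ℝ → ℝ := fun s => N * (2 * Real.arctan (c * s))
      - ((n : ℝ) - 1) * (π - 2 * Real.arctan (phaseCoeff c * s)) with hh
    have hcont : Continuous h := by fun_prop
    have hpos : 0 < h 1 := by
      have h1 := arctan_phaseCoeff hc
      have h2 := Real.arctan_pos.2 hc.1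
      have h3 : (2 * n : ℝ) ≤ N + 1 := by exact_mod_cast hnN
      simp only [hh, mul_one]
      nlinarith
    have hev : ∀ᶠ s in 𝓝[<] (1 : ℝ), 0 < h s :=
      ((hcont.tendsto 1).mono_left nhdsWithin_le_nhds).eventually (lt_mem_nhds hpos)
    obtain ⟨s, hs, hs1⟩ := (hev.and (Ioo_mem_nhdsLT (show (0 : ℝ) < 1 by norm_num))).exists
    refine ⟨artanh s, ?_⟩
    rw [rapidityPhase, rapidityPhase, Real.tanh_artanh ⟨by linarith [hs1.1], hs1.2⟩]
    simp only [hh] at hs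
    linarith
  have hmono := fun {c : ℝ} (hc : 0 < c) => (rapidityPhase_strictMono hc).monotone
  obtain ⟨a, ha⟩ := exists_betheMap_eq (n := n) (κ := π)
    (σ := fun j l => (if l < j then π else 0) - if j < l then π else 0)
    (continuous_rapidityPhase c) (continuous_rapidityPhase (phaseCoeff c)) (hmono hc.1)
    (hmono (phaseCoeff_pos hc)) (rapidityPhase_neg _) (rapidityPhase_neg _)
    (fun j l => by ring)
    (fun j l => by
      have := Real.pi_pos
      rcases lt_trichotomy j l with h | h | h
      · simp [h, h.not_gt, abs_of_pos this]
      · simp [h, this.le]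
      · simp [h, h.not_gt, abs_of_pos this])
    (by
      have := Real.arctan_lt_pi_div_two (phaseCoeff c * tanh r)
      rw [rapidityPhase]; linarith)
    hr
  exact ⟨a, funext fun j => (ha j).trans (betheNumber_eq_sum j).symm⟩

theorem contDiffAt_rapidityPhase_comp {E : Type*} [NormedAddCommGroup E] [NormedSpace ℝ E]
    {m : WithTop ℕ∞} {u v : E → ℝ} {x : E} (hu : ContDiffAt ℝ m u x) (hv : ContDiffAt ℝ m v x) :
    ContDiffAt ℝ m (fun y => rapidityPhase (u y) (v y)) x :=
  contDiffAt_const.mul (Real.contDiff_arctan.contDiffAt.comp x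
    (hu.mul (contDiff_tanh.contDiffAt.comp x hv)))

theorem contDiffAt_betheRapidityMap {c : ℝ} (hc : c ≠ 0) (a : Fin n → ℝ) {m : WithTop ℕ∞} :
    ContDiffAt ℝ m (fun q : ℝ × (Fin n → ℝ) => betheRapidityMap N q.1 q.2) (c, a) := by
  have happ : ∀ j, ContDiffAt ℝ m (fun q : ℝ × (Fin n → ℝ) => q.2 j) (c, a) := fun j =>
    (contDiff_apply ℝ ℝ j).contDiffAt.comp (c, a) contDiffAt_snd
  have hphase : ContDiffAt ℝ m (fun q : ℝ × (Fin n → ℝ) => phaseCoeff q.1) (c, a) := by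
    unfold phaseCoeff
    refine ContDiffAt.div (by fun_prop) (by fun_prop) ?_
    simpa using hc
  refine contDiffAt_pi.2 fun j => ?_
  refine (contDiffAt_const.mul (contDiffAt_rapidityPhase_comp contDiffAt_fst (happ j))).add ?_
  exact ContDiffAt.sum fun l _ => contDiffAt_rapidityPhase_comp hphase ((happ j).sub (happ l))

theorem hasDerivAt_betheRapidityMap (c : ℝ) (a v : Fin n → ℝ) :
    HasDerivAt (fun s : ℝ => betheRapidityMap N c (a + s • v))
      (fun j => N * (rapiditySlope c (a j) * v j)
        + ∑ l, rapiditySlope (phaseCoeff c) (a j - a l) * (v j - v l)) 0 := by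
  have hline : ∀ b x w : ℝ,
      HasDerivAt (fun s : ℝ => rapidityPhase b (x + s * w)) (rapiditySlope b x * w) 0 := by
    intro b x w
    have h1 : HasDerivAt (fun s : ℝ => x + s * w) w 0 := by
      simpa using ((hasDerivAt_id (0 : ℝ)).mul_const w).const_add x
    have := (hasDerivAt_rapidityPhase b (x + 0 * w)).comp (0 : ℝ) h1
    simpa [Function.comp_def] using this
  refine hasDerivAt_pi.2 fun j => ?_
  refine ((hline c (a j) (v j)).const_mul _).add (HasDerivAt.fun_sum fun l _ => ?_)
  have e : ∀ s : ℝ, (a + s • v) j - (a + s • v) l = (a j - a l) + s * (v j - v l) := fun s => by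
    simp; ring
  simp only [e]
  exact hline _ _ _

/-- The infinitesimal form of `betheMap_injective`: pairing with v gives a positive definite
quadratic form. -/
theorem eq_zero_of_linearized_eq_zero (hN : 0 < N) {c : ℝ} (hc : c ∈ Ioo (0 : ℝ) 1)
    {a v : Fin n → ℝ} (h : ∀ j, N * (rapiditySlope c (a j) * v j)
        + ∑ l, rapiditySlope (phaseCoeff c) (a j - a l) * (v j - v l) = 0) : v = 0 := by
  have key : ∑ j, v j * (N * (rapiditySlope c (a j) * v j))
      + ∑ j, v j * ∑ l, rapiditySlope (phaseCoeff c) (a j - a l) * (v j - v l) = 0 := by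
    rw [← Finset.sum_add_distrib]
    refine Finset.sum_eq_zero fun j _ => ?_
    rw [← mul_add, h j, mul_zero]
  rw [sum_mul_sum_of_antisymm] at key
  · have h2 : 0 ≤ ∑ j, ∑ l,
        rapiditySlope (phaseCoeff c) (a j - a l) * (v j - v l) * (v j - v l) := by
      refine Finset.sum_nonneg fun j _ => Finset.sum_nonneg fun l _ => ?_
      rw [mul_assoc]
      exact mul_nonneg (rapiditySlope_pos (phaseCoeff_pos hc) _).le (mul_self_nonneg _)
    have h3 : ∀ j, v j * (N * (rapiditySlope c (a j) * v j))
        = N * rapiditySlope c (a j) * (v j * v j) := fun j => by ring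
    have hpos : ∀ j, 0 < N * rapiditySlope c (a j) := fun j =>
      mul_pos (by exact_mod_cast hN) (rapiditySlope_pos hc.1 _)
    simp only [h3] at key
    have h4 : ∀ j ∈ Finset.univ, 0 ≤ N * rapiditySlope c (a j) * (v j * v j) := fun j _ =>
      mul_nonneg (hpos j).le (mul_self_nonneg _)
    have h5 := le_antisymm (by linarith) (Finset.sum_nonneg h4)
    funext j
    have := (Finset.sum_eq_zero_iff_of_nonneg h4).1 h5 j (Finset.mem_univ j)
    exact mul_self_eq_zero.1 ((mul_eq_zero.1 this).resolve_left (hpos j).ne')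
  · intro j l
    rw [← neg_sub (a j), rapiditySlope_neg]
    ring

/-- No regularity of β is assumed: global injectivity makes it agree near c with the analytic
implicit function. -/
theorem contDiffAt_of_betheRapidityMap_eq (hN : 0 < N) {β : ℝ → Fin n → ℝ} {b : Fin n → ℝ}
    (hβ : ∀ c ∈ Ioo (0 : ℝ) 1, betheRapidityMap N c (β c) = b) {c : ℝ}
    (hc : c ∈ Ioo (0 : ℝ) 1) : ContDiffAt ℝ ω β c := by
  set f : ℝ × (Fin n → ℝ) → Fin n → ℝ := fun q => betheRapidityMap N q.1 q.2 with hf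
  have cdf : ContDiffAt ℝ ω f (c, β c) := contDiffAt_betheRapidityMap hc.1.ne' _
  set L := fderiv ℝ f (c, β c) ∘L .inr ℝ ℝ (Fin n → ℝ) with hL
  have hinj : Function.Injective L := by
    refine (injective_iff_map_eq_zero L).2 fun v hv => ?_
    have hline : HasDerivAt (fun s : ℝ => ((c, β c + s • v) : ℝ × (Fin n → ℝ))) (0, v) 0 := by
      refine (hasDerivAt_const _ _).prodMk ?_
      simpa using ((hasDerivAt_id (0 : ℝ)).smul_const v).const_add (β c)
    have hd : HasFDerivAt f (fderiv ℝ f (c, β c)) (c, β c + (0 : ℝ) • v) := by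
      simpa using (cdf.differentiableAt (by simp)).hasFDerivAt
    have h1 := hd.comp_hasDerivAt (0 : ℝ) hline
    have h2 := h1.unique (hasDerivAt_betheRapidityMap (N := N) c (β c) v)
    have h3 : fderiv ℝ f (c, β c) (0, v) = 0 := by simpa [hL] using hv
    rw [h3] at h2
    exact eq_zero_of_linearized_eq_zero hN hc fun j => (congrFun h2 j).symm
  have hinv : L.IsInvertible := by
    refine ⟨(LinearEquiv.ofInjectiveEndo L.toLinearMap hinj).toContinuousLinearEquiv, ?_⟩
    ext v j
    rfl
  have hψ := cdf.contDiffAt_implicitFunction (by simp) hinv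
  refine hψ.congr_of_eventuallyEq ?_
  filter_upwards [cdf.eventually_apply_implicitFunction (by simp) hinv,
    isOpen_Ioo.mem_nhds hc] with c' hc' hmem
  refine betheRapidityMap_injective hN hmem ?_
  rw [hβ c' hmem]
  exact ((hβ c hc).symm.trans hc'.symm)

theorem bethe_iff_betheRapidityMap_eq {t : ℝ} (ht : t ∈ Ioo 0 (√2)) (a : Fin n → ℝ) :
    (∀ j : Fin n, (N : ℝ) * rapidityPhase (betheTan t) (a j)
      = 2 * π * ((j : ℕ) + 1 : ℝ) - ((n : ℝ) + 1) * π
      - ∑ k : Fin n, betheTheta t (rapidityPhase (betheTan t) (a j))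
          (rapidityPhase (betheTan t) (a k)))
      ↔ betheRapidityMap N (betheTan t) a = betheNumber := by
  rw [funext_iff]
  refine forall_congr' fun j => ?_
  simp only [betheTheta_rapidityPhase ht, betheRapidityMap, betheMap, betheNumber]
  exact eq_sub_iff_add_eq

theorem betheRapidityMap_neg_rev (c : ℝ) (a : Fin n → ℝ) (j : Fin n) :
    betheRapidityMap N c (fun l => -a (Fin.rev l)) j
      = -betheRapidityMap N c a (Fin.rev j) := by
  have h : ∀ l, rapidityPhase (phaseCoeff c) (-a (Fin.rev j) - -a (Fin.rev l))
      = -rapidityPhase (phaseCoeff c) (a (Fin.rev j) - a (Fin.rev l)) := fun l => by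
    rw [← rapidityPhase_neg]; congr 1; ring
  simp only [betheRapidityMap, betheMap, h, rapidityPhase_neg, Finset.sum_neg_distrib]
  rw [Equiv.sum_comp Fin.revPerm
    (fun l => rapidityPhase (phaseCoeff c) (a (Fin.rev j) - a l)) |>.symm]
  simp only [Fin.revPerm_apply]
  ring

theorem betheNumber_rev (j : Fin n) : betheNumber (Fin.rev j) = -betheNumber j := by
  have h : ((Fin.rev j : ℕ) : ℝ) = n - (j + 1) := by
    rw [Fin.val_rev, Nat.cast_sub j.2]; simp
  rw [betheNumber, betheNumber, h]
  ring

theorem betheNumber_injective : Function.Injective (betheNumber (n := n)) := by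
  intro j k h
  have h2 : 2 * π * ((j : ℕ) : ℝ) = 2 * π * ((k : ℕ) : ℝ) := by
    unfold betheNumber at h; linarith
  have h3 := mul_left_cancel₀ Real.two_pi_pos.ne' h2
  exact Fin.ext (by exact_mod_cast h3)

theorem IsAnalyticBetheSolution.eqOn (hN : 0 < N) {p q : Fin n → ℝ → ℝ}
    (hp : IsAnalyticBetheSolution n N p) (hq : IsAnalyticBetheSolution n N q) (j : Fin n) :
    EqOn (q j) (p j) (Ioo 0 (√2)) := by
  intro t ht
  choose a ha using fun k => exists_rapidityPhase_eq ht (hp.mem t ht k)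
  choose b hb using fun k => exists_rapidityPhase_eq ht (hq.mem t ht k)
  have h1 := hp.bethe t ht
  have h2 := hq.bethe t ht
  simp only [← ha] at h1
  simp only [← hb] at h2
  have hab := betheRapidityMap_injective hN (betheTan_mem ht)
    (((bethe_iff_betheRapidityMap_eq ht b).1 h2).trans
      ((bethe_iff_betheRapidityMap_eq ht a).1 h1).symm)
  rw [← ha, ← hb, hab]

end Bethe

end
theorem mainTheorem3 (n N : ℕ) (hnN : 2 * n ≤ N + 1) :
    ∃ p : Fin n → ℝ → ℝ,
      IsAnalyticBetheSolution n N p ∧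
      (∀ q : Fin n → ℝ → ℝ, IsAnalyticBetheSolution n N q →
        ∀ j, Set.EqOn (q j) (p j) (Set.Ioo 0 (√2))) ∧
      (∀ t ∈ Set.Ioo (0 : ℝ) (√2), ∀ j, p (Fin.rev j) t = -p j t) ∧
      (∀ t ∈ Set.Ioo (0 : ℝ) (√2), Function.Injective fun j => p j t) := by
  -- N = 0 is possible only when n = 0, so positivity is available as soon as an index is given.
  have hN : Fin n → 0 < N := fun j => by have := j.pos; omega
  choose! β hβ using fun c (hc : c ∈ Ioo (0 : ℝ) 1) =>
    exists_betheRapidityMap_eq (n := n) (N := N) hnN hc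
  have hsol : IsAnalyticBetheSolution n N
      fun j t => rapidityPhase (betheTan t) (β (betheTan t) j) := by
    refine ⟨fun j t ht => ?_, fun t ht j => rapidityPhase_mem_betheInterval ht _,
      fun t ht => (bethe_iff_betheRapidityMap_eq ht _).2 (hβ _ (betheTan_mem ht))⟩
    -- In `WithTop ℕ∞` the top element is `ω`, the analytic class.
    have hT := contDiffAt_betheTan ht (m := ⊤)
    refine ContDiffAt.analyticAt (contDiffAt_rapidityPhase_comp hT ?_)
    exact contDiffAt_pi.1 ((contDiffAt_of_betheRapidityMap_eq (hN j) hβ (betheTan_mem ht)).comp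
      t hT) j
  refine ⟨_, hsol, fun q hq j => hsol.eqOn (hN j) hq j, fun t ht j => ?_, fun t ht j k hjk => ?_⟩
  · have hc := betheTan_mem ht
    -- The negated, reversed solution solves the same equations.
    have h : (fun l => -β (betheTan t) (Fin.rev l)) = β (betheTan t) := by
      refine betheRapidityMap_injective (hN j) hc (funext fun l => ?_)
      rw [betheRapidityMap_neg_rev, hβ _ hc, betheNumber_rev, neg_neg]
    have hj := congrFun h j
    rw [← rapidityPhase_neg, ← hj, neg_neg]
  · have hc := betheTan_mem ht
    have hβjk := (rapidityPhase_strictMono hc.1).injective hjk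
    -- The left-hand side depends on the index only through its rapidity, so coinciding roots would
    -- share a quantum number.
    apply betheNumber_injective
    rw [← hβ _ hc]
    simp only [betheRapidityMap, betheMap, hβjk]
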